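/- Let $\sigma_1=\begin{pmatrix}0&1\\1&0\end{pmatrix}$, $\sigma_2=\begin{pmatrix}0&-i\\i&0\end{pmatrix}$, $\sigma_3=\begin{pmatrix}1&0\\0&-1\end{pmatrix}$ be the Pauli matrices and let $\alpha_j=\begin{pmatrix}0&\sigma_j\\ \sigma_j&0\end{pmatrix}$, $j=1,2,3$, be the $4\times4$ Dirac matrices. Write $\langle x\rangle=\sqrt{1+|x|^2}$ for $x\in\mathbb R^3$. For $s\in\mathbb R$ let $\mathcal L^{2,s}$ be the space of measurable functions $f:\mathbb R^3\to\mathbb C^4$ (modulo equality almost everywhere) with $\langle x\rangle^s f\in L^2(\mathbb R^3;\mathbb C^4)$. Let $H_0=\alpha\cdot D=\sum_{j=1}^3\alpha_j\,\frac1i\,\partial_{x_j}$ be the free massless Dirac operator, acting on $\mathbb C^4$-valued tempered distributions on $\mathbb R^3$, and for $g\in L^2(\mathbb R^3;\mathbb C^4)$ let $$(Ag)(x)=\int_{\mathbb R^3} i\,\frac{\alpha\cdot(x-y)}{4\pi|x-y|^3}\,g(y)\,dy,\qquad \alpha\cdot v=\sum_{j=1}^3 v_j\alpha_j .$$ Theorem.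 Let $f\in\mathcal L^{2,-3/2}$, and suppose that, in the sense of distributions, $H_0f\in\mathcal L^{2,s}$ for some $s>1/2$. Then $AH_0f=f$; that is, for almost every $x\in\mathbb R^3$ the integral defining $(AH_0f)(x)$ converges absolutely and its value is $f(x)$. -/

import Mathlib

open MeasureTheory
open scoped SchwartzMap LineDeriv

noncomputable section

namespace MasslessDirac

/-- The configuration space `ℝ³` with its Euclidean norm. -/
abbrev Space : Type := EuclideanSpace ℝ (Fin 3)

/-- The space `ℂ⁴` of spinors with its Euclidean norm. -/
abbrev Spinor : Type := EuclideanSpace ℂ (Fin 4)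

/-- The Pauli matrices `σ₁, σ₂, σ₃`. -/
def pauli : Fin 3 → Matrix (Fin 2) (Fin 2) ℂ :=
  ![!![0, 1; 1, 0], !![0, -Complex.I; Complex.I, 0], !![1, 0; 0, -1]]

/-- The Dirac matrices `αⱼ`, with `2 × 2` zero blocks on the diagonal and the Pauli matrix `σⱼ` in
both off-diagonal blocks. -/
def dirac (j : Fin 3) : Matrix (Fin 4) (Fin 4) ℂ :=
  Matrix.reindex finSumFinEquiv finSumFinEquiv (Matrix.fromBlocks 0 (pauli j) (pauli j) 0)

/-- The matrix `α · v = ∑ⱼ vⱼ αⱼ` for a vector `v ∈ ℝ³`. -/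
def diracDot (v : Space) : Matrix (Fin 4) (Fin 4) ℂ :=
  ∑ j : Fin 3, (v j : ℂ) • dirac j

/-- The power `⟨x⟩ ^ s` of the weight `⟨x⟩ = √(1 + |x|²)`. -/
def weight (s : ℝ) (x : Space) : ℝ :=
  Real.sqrt (1 + ‖x‖ ^ 2) ^ s

/-- Membership of a spinor-valued function in the weighted space `𝓛^{2,s} = [L^{2,s}(ℝ³)]⁴`:
the function `⟨x⟩ ^ s f` is (measurable and) square integrable. -/
def MemWeightedL2 (s : ℝ) (f : Space → Spinor) : Prop :=
  MemLp (fun x => (weight s x : ℂ) • f x) 2 volume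

/-- The tempered distribution `φ ↦ ∫ φ(x) f(x) dx` given by a function `f ∈ 𝓛^{2,s}`, built as
`⟨x⟩ ^ (-s)` times the distribution of the square integrable function `⟨x⟩ ^ s f`. See
`toDistribution_apply` for the formula. -/
def toDistribution {s : ℝ} {f : Space → Spinor} (hf : MemWeightedL2 s f) : 𝓢'(Space, Spinor) :=
  TemperedDistribution.smulLeftCLM Spinor (fun x => (weight (-s) x : ℂ))
    (Lp.toTemperedDistribution (MemLp.toLp _ hf))

/-- The free massless Dirac operator `H₀ = α · D = ∑ⱼ αⱼ (1 / i) ∂ⱼ` on `[𝓢'(ℝ³)]⁴`, in the sense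
of distributions: for a Schwartz function `φ`, the value `(H₀ u)(φ)` is obtained by applying the
matrices `αⱼ` to the values `((1 / i) ∂ⱼ u)(φ) ∈ ℂ⁴`. -/
def freeDirac (u : 𝓢'(Space, Spinor)) : 𝓢'(Space, Spinor) :=
  ∑ j : Fin 3, PointwiseConvergenceCLM.postcomp (𝓢(Space, ℂ))
    (Matrix.toEuclideanCLM (n := Fin 4) (𝕜 := ℂ) (dirac j))
    ((1 / Complex.I) • ∂_{EuclideanSpace.single j (1 : ℝ)} u)

/-- The integrand `i α · (x - y) / (4π |x - y|³) g(y)`; its value at the single point `y = x` is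
irrelevant. -/
def kernelApply (g : Space → Spinor) (x y : Space) : Spinor :=
  (Complex.I / (4 * Real.pi * ‖x - y‖ ^ 3 : ℝ)) •
    Matrix.toEuclideanCLM (n := Fin 4) (𝕜 := ℂ) (diracDot (x - y)) (g y)

/-- The singular integral operator `(A g)(x) = ∫ i α · (x - y) / (4π |x - y|³) g(y) dy`. -/
def opA (g : Space → Spinor) (x : Space) : Spinor :=
  ∫ y, kernelApply g x y

lemma weight_hasTemperateGrowth (s : ℝ) :
    (fun x : Space => (weight s x : ℂ)).HasTemperateGrowth := by
  have h : (weight s) = fun x : Space => (1 + ‖x‖ ^ 2) ^ (s / 2) := by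
    funext x
    have : (0 : ℝ) ≤ 1 + ‖x‖ ^ 2 := by positivity
    rw [weight, Real.sqrt_eq_rpow, ← Real.rpow_mul this]
    congr 1
    ring
  rw [h]
  fun_prop

lemma weight_neg_mul_weight (s : ℝ) (x : Space) :
    (weight (-s) x : ℂ) * (weight s x : ℂ) = 1 := by
  have h : 0 < Real.sqrt (1 + ‖x‖ ^ 2) := Real.sqrt_pos.2 (by positivity)
  rw [← Complex.ofReal_mul, weight, weight, ← Real.rpow_add h]
  simp

/-- The tempered distribution of `f ∈ 𝓛^{2,s}` is integration against `f`. -/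
lemma toDistribution_apply {s : ℝ} {f : Space → Spinor} (hf : MemWeightedL2 s f)
    (φ : 𝓢(Space, ℂ)) : toDistribution hf φ = ∫ x, φ x • f x := by
  rw [toDistribution, TemperedDistribution.smulLeftCLM_apply_apply,
    Lp.toTemperedDistribution_apply]
  apply integral_congr_ae
  filter_upwards [MemLp.coeFn_toLp hf] with x hx
  rw [hx, SchwartzMap.smulLeftCLM_apply_apply (weight_hasTemperateGrowth (-s)), smul_smul,
    smul_eq_mul, mul_right_comm, weight_neg_mul_weight, one_mul]

/-- `(H₀ u)(φ) = ∑ⱼ (1 / i) αⱼ u(-∂ⱼ φ)`. -/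
lemma freeDirac_apply (u : 𝓢'(Space, Spinor)) (φ : 𝓢(Space, ℂ)) :
    freeDirac u φ = ∑ j : Fin 3, Matrix.toEuclideanCLM (n := Fin 4) (𝕜 := ℂ) (dirac j)
      ((1 / Complex.I) • u (-∂_{EuclideanSpace.single j (1 : ℝ)} φ)) := by
  rw [freeDirac, Fin.sum_univ_three, Fin.sum_univ_three]
  rfl

end MasslessDirac

end

namespace MasslessDirac

open Filter Topology
open scoped ContDiff Convolution

/-! Since `H₀² = -Δ`, the kernel of `A` is `H₀` applied to `1 / (4π|z|)`, so formally `A = H₀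
(-Δ)⁻¹` inverts `H₀`. As `f` may grow at infinity, this is made rigorous by duality and a cutoff.

For a real test function `ψ`, Fubini moves `A` onto `ψ`: with `g = H₀ f`, the integral of `ψ A g`
equals that of `∑ⱼ uⱼ i αⱼ g`, where `u` is the Coulomb field of `ψ`, formally the gradient of its
Newtonian potential. Three facts about `u` are needed: it is curl free (`fderiv_coulombField_comm`),
its divergence is `-ψ` (`sum_fderiv_coulombField`), and it is `O(⟨y⟩⁻²)`
(`exists_abs_coulombField_le`).

Testing `H₀ f = g` against `χ uⱼ`, with `χ` a cutoff at scale `r`, produces `-∑ⱼₖ αⱼ αₖ ∫ ∂ₖ(χ uⱼ)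
f`. Because `∂ₖ uⱼ` is symmetric, the anticommutation relations reduce the part without `∂ₖ χ` to
minus the divergence, that is to `∫ χ ψ f` (`sum_integral_cutoff_smul`). The part with `∂ₖ χ` lives
on a shell of radius about `r`. There `uⱼ ∂ₖ χ = O(r⁻³)` and `|f|` is at most a multiple of `r^(3/2)
|F|` with `F` in `L²`. Cauchy–Schwarz on a volume of order `r³` cancels the powers of `r` exactly
and leaves the `L²` norm of `F` on the shell, which tends to `0`. Hence `A g` and `f` agree against
every `ψ`. -/

/-- The `j`-th standard basis vector of `ℝ³`. -/
noncomputable abbrev basisVec (j : Fin 3) : Space := EuclideanSpace.single j (1 : ℝ)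

/-! ### The Coulomb kernel: size and local integrability. -/

/-- The `j`-th component `zⱼ / (4π |z|³)` of the gradient of the fundamental solution of the
Laplace operator. -/
noncomputable def coulomb (j : Fin 3) (z : Space) : ℝ := z j / (4 * Real.pi * ‖z‖ ^ 3)

lemma abs_apply_le_norm (z : Space) (j : Fin 3) : |z j| ≤ ‖z‖ := by
  simpa using PiLp.norm_apply_le z j

lemma measurable_coulomb (j : Fin 3) : Measurable (coulomb j) := by
  unfold coulomb
  fun_prop

lemma div_norm_pow_three (z : Space) : ‖z‖ / ‖z‖ ^ 3 = (‖z‖ ^ 2)⁻¹ := by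
  rcases eq_or_ne ‖z‖ 0 with h | h
  · simp [h]
  · field_simp

lemma abs_coulomb_le (j : Fin 3) (z : Space) : |coulomb j z| ≤ (‖z‖ ^ 2)⁻¹ := by
  have h : (1 : ℝ) ≤ 4 * Real.pi := by linarith [Real.pi_gt_three]
  rw [coulomb, abs_div, abs_of_nonneg (by positivity : 0 ≤ 4 * Real.pi * ‖z‖ ^ 3), ← div_div,
    ← div_norm_pow_three]
  gcongr
  exact (div_le_self (abs_nonneg _) h).trans (abs_apply_le_norm z j)

lemma locallyIntegrable_inv_norm_sq :
    LocallyIntegrable (fun z : Space => (‖z‖ ^ 2)⁻¹) volume := by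
  refine locallyIntegrable_of_norm_le_rpow (C := 1) (α := 2) (by simp) (by simp; norm_num)
    (.of_forall fun z => ?_) (by fun_prop)
  rw [Real.rpow_neg (norm_nonneg _)]
  simp

lemma locallyIntegrable_coulomb (j : Fin 3) : LocallyIntegrable (coulomb j) volume :=
  locallyIntegrable_inv_norm_sq.mono (measurable_coulomb j).aestronglyMeasurable
    (.of_forall fun z => by
      rw [Real.norm_eq_abs, Real.norm_of_nonneg (by positivity)]
      exact abs_coulomb_le j z)

/-! ### The Coulomb kernel is curl free in the weak sense. -/

section Curl

variable {φ : Space → ℝ}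

lemma hasCompactSupport_fderiv_apply (hs : HasCompactSupport φ) (v : Space) :
    HasCompactSupport fun z => fderiv ℝ φ z v :=
  hs.fderiv_apply (𝕜 := ℝ) v

lemma integrable_coulomb_mul (j : Fin 3) (hφ : Continuous φ) (hs : HasCompactSupport φ) :
    Integrable (fun z => coulomb j z * φ z) volume := by
  simpa [smul_eq_mul, mul_comm] using
    (locallyIntegrable_coulomb j).integrable_smul_left_of_hasCompactSupport hφ hs

lemma hasFDerivAt_regularised {ε : ℝ} (hε : 0 < ε) (z : Space) :
    HasFDerivAt (fun z : Space => (‖z‖ ^ 2 + ε ^ 2) ^ (-(1 / 2) : ℝ))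
      ((-(1 / 2) * (‖z‖ ^ 2 + ε ^ 2) ^ (-(1 / 2) - 1 : ℝ)) • (2 • innerSL ℝ z)) z := by
  have h : HasFDerivAt (fun z : Space => ‖z‖ ^ 2 + ε ^ 2) (2 • innerSL ℝ z) z :=
    (hasStrictFDerivAt_norm_sq z).hasFDerivAt.add_const _
  exact h.rpow_const (Or.inl (by positivity))

lemma fderiv_regularised_apply {ε : ℝ} (hε : 0 < ε) (z : Space) (j : Fin 3) :
    fderiv ℝ (fun z : Space => (‖z‖ ^ 2 + ε ^ 2) ^ (-(1 / 2) : ℝ)) z (basisVec j) =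
      -(z j * (‖z‖ ^ 2 + ε ^ 2) ^ (-(3 / 2) : ℝ)) := by
  rw [(hasFDerivAt_regularised hε z).fderiv]
  norm_num [basisVec, EuclideanSpace.inner_single_right]
  ring

lemma continuous_rpow_regularised {ε : ℝ} (hε : 0 < ε) (a : ℝ) :
    Continuous fun z : Space => (‖z‖ ^ 2 + ε ^ 2) ^ a :=
  Continuous.rpow_const (by fun_prop) fun z => Or.inl (by positivity)

/-- The regularised kernel is minus the gradient of `(|z|² + ε²)^(-1/2)`, which is smooth at the
origin. Integrating by parts therefore gives no singular term and leaves a second derivative of `φ`,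
symmetric in `j` and `k`. -/
lemma integral_regularised_eq (hφ : ContDiff ℝ 2 φ) (hs : HasCompactSupport φ) {ε : ℝ}
    (hε : 0 < ε) (j k : Fin 3) :
    ∫ z : Space, (z j * (‖z‖ ^ 2 + ε ^ 2) ^ (-(3 / 2) : ℝ)) * fderiv ℝ φ z (basisVec k) =
      ∫ z : Space, (‖z‖ ^ 2 + ε ^ 2) ^ (-(1 / 2) : ℝ) *
        fderiv ℝ (fderiv ℝ φ) z (basisVec j) (basisVec k) := by
  have hφ' : ContDiff ℝ 1 fun z => fderiv ℝ φ z (basisVec k) :=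
    (hφ.fderiv_right (m := 1) (by norm_num)).clm_apply contDiff_const
  have hs' := hasCompactSupport_fderiv_apply hs (basisVec k)
  have h2 : ∀ z, fderiv ℝ (fderiv ℝ φ) z (basisVec j) (basisVec k) =
      fderiv ℝ (fun z => fderiv ℝ φ z (basisVec k)) z (basisVec j) := fun z => by
    rw [fderiv_clm_apply ((hφ.fderiv_right (m := 1) (by norm_num)).differentiable
      (by norm_num) z) (by fun_prop)]
    simp
  have hc := continuous_rpow_regularised hε (-(1 / 2))
  have hc3 := continuous_rpow_regularised hε (-(3 / 2))
  have key := integral_mul_fderiv_eq_neg_fderiv_mul_of_integrable (μ := volume)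
    (f := fun z : Space => (‖z‖ ^ 2 + ε ^ 2) ^ (-(1 / 2) : ℝ))
    (g := fun z => fderiv ℝ φ z (basisVec k)) (v := basisVec j)
    ?_ ?_ ?_ (fun z _ => (hasFDerivAt_regularised hε z).differentiableAt)
    (fun z _ => hφ'.differentiable (by norm_num) z)
  · simp_rw [h2, key, fderiv_regularised_apply hε, neg_mul, integral_neg, neg_neg]
  · simp_rw [fderiv_regularised_apply hε]
    exact Continuous.integrable_of_hasCompactSupport (by fun_prop) hs'.mul_left
  · exact Continuous.integrable_of_hasCompactSupport
      (hc.mul ((hφ'.continuous_fderiv (by norm_num)).clm_apply continuous_const))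
      (hasCompactSupport_fderiv_apply hs' _).mul_left
  · exact Continuous.integrable_of_hasCompactSupport (by fun_prop) hs'.mul_left

/-- The bound does not depend on `ε`, so it provides the dominating function for `ε → 0`. -/
lemma rpow_regularised_le {ε : ℝ} (z : Space) (j : Fin 3) :
    ‖z j * (‖z‖ ^ 2 + ε ^ 2) ^ (-(3 / 2) : ℝ)‖ ≤ (‖z‖ ^ 2)⁻¹ := by
  rcases eq_or_ne z 0 with rfl | hz
  · simp
  have hz' : 0 < ‖z‖ := norm_pos_iff.2 hz
  have h1 : (‖z‖ ^ 2) ^ (-(3 / 2) : ℝ) = (‖z‖ ^ 3)⁻¹ := by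
    rw [← Real.rpow_natCast, ← Real.rpow_natCast, ← Real.rpow_mul hz'.le, ← Real.rpow_neg hz'.le]
    norm_num
  rw [norm_mul, ← div_norm_pow_three, div_eq_mul_inv ‖z‖, ← h1,
    Real.norm_of_nonneg (Real.rpow_nonneg (by positivity) _)]
  exact mul_le_mul (abs_apply_le_norm z j)
    (Real.rpow_le_rpow_of_nonpos (by positivity) (by nlinarith) (by norm_num))
    (Real.rpow_nonneg (by positivity) _) (norm_nonneg _)

lemma tendsto_integral_regularised (hφ : Continuous φ) (hs : HasCompactSupport φ) (j : Fin 3) :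
    Tendsto (fun n : ℕ => ∫ z : Space,
        (z j * (‖z‖ ^ 2 + (1 / ((n : ℝ) + 1)) ^ 2) ^ (-(3 / 2) : ℝ)) * φ z) atTop
      (𝓝 (4 * Real.pi * ∫ z, coulomb j z * φ z)) := by
  rw [← integral_const_mul]
  refine tendsto_integral_of_dominated_convergence (fun z => (‖z‖ ^ 2)⁻¹ * ‖φ z‖) (fun n => ?_) ?_
    (fun n => .of_forall fun z => ?_) (.of_forall fun z => ?_)
  · have := continuous_rpow_regularised (ε := 1 / ((n : ℝ) + 1)) (by positivity) (-(3 / 2))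
    exact Continuous.aestronglyMeasurable (by fun_prop)
  · simpa [smul_eq_mul, mul_comm] using
      locallyIntegrable_inv_norm_sq.integrable_smul_left_of_hasCompactSupport hφ.norm hs.norm
  · rw [norm_mul]
    gcongr
    exact rpow_regularised_le z j
  · rcases eq_or_ne z 0 with rfl | hz
    · simp [coulomb]
    have hz' : 0 < ‖z‖ := norm_pos_iff.2 hz
    -- The limit is written with `ε = 0` kept as `0 ^ 2`, to match continuity of the regularised
    -- kernel in `ε`.
    have h1 : (‖z‖ ^ 2 + 0 ^ 2) ^ (-(3 / 2) : ℝ) = (‖z‖ ^ 3)⁻¹ := by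
      rw [zero_pow two_ne_zero, add_zero, ← Real.rpow_natCast, ← Real.rpow_natCast,
        ← Real.rpow_mul hz'.le, ← Real.rpow_neg hz'.le]
      norm_num
    have h2 : 4 * Real.pi * (coulomb j z * φ z) =
        (z j * (‖z‖ ^ 2 + 0 ^ 2) ^ (-(3 / 2) : ℝ)) * φ z := by
      rw [h1, coulomb]
      field_simp
    rw [h2]
    refine Tendsto.mul_const _ (Tendsto.const_mul _ (Tendsto.rpow_const ?_ (Or.inl ?_)))
    · exact ((tendsto_one_div_add_atTop_nhds_zero_nat (𝕜 := ℝ)).pow 2).const_add _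
    · positivity

/-- The Coulomb field of a test function is curl free. -/
theorem integral_coulomb_mul_fderiv_comm (hφ : ContDiff ℝ 2 φ) (hs : HasCompactSupport φ)
    (j k : Fin 3) :
    ∫ z, coulomb j z * fderiv ℝ φ z (basisVec k) =
      ∫ z, coulomb k z * fderiv ℝ φ z (basisVec j) := by
  have hc : ∀ l, Continuous fun z => fderiv ℝ φ z (basisVec l) := fun l =>
    (hφ.continuous_fderiv (by norm_num)).clm_apply continuous_const
  have h1 := tendsto_integral_regularised (hc k) (hasCompactSupport_fderiv_apply hs _) j
  have h2 := tendsto_integral_regularised (hc j) (hasCompactSupport_fderiv_apply hs _) k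
  have h3 : ∀ z, fderiv ℝ (fderiv ℝ φ) z (basisVec j) (basisVec k) =
      fderiv ℝ (fderiv ℝ φ) z (basisVec k) (basisVec j) := fun z =>
    (hφ.contDiffAt.isSymmSndFDerivAt (by simp)).eq _ _
  have h4 := tendsto_nhds_unique (h1.congr fun n => by
    rw [integral_regularised_eq hφ hs (by positivity) j k,
      integral_regularised_eq hφ hs (by positivity) k j]
    simp_rw [h3]) h2
  exact mul_left_cancel₀ (by positivity) h4

end Curl

/-! ### The weak divergence of the Coulomb kernel is a point mass. -/

section Divergence

variable {φ : Space → ℝ}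

/-- Integration in polar coordinates on `ℝ³`. -/
lemma integral_eq_integral_sphere {F : Space → ℝ} (hF : Integrable F volume) :
    ∫ z, F z = ∫ θ : Metric.sphere (0 : Space) 1, (∫ r in Set.Ioi (0 : ℝ),
      r ^ 2 * F (r • (θ : Space))) ∂(volume : Measure Space).toSphere := by
  have hmp := (volume : Measure Space).measurePreserving_homeomorphUnitSphereProd
  have hemb := (homeomorphUnitSphereProd Space).measurableEmbedding
  let G : Metric.sphere (0 : Space) 1 × Set.Ioi (0 : ℝ) → ℝ :=
    fun p => F (p.2.1 • (p.1 : Space))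
  have hG : ∀ z : ({(0)}ᶜ : Set Space), G (homeomorphUnitSphereProd Space z) = F z := fun z => by
    have hz : ‖(z : Space)‖ ≠ 0 := norm_ne_zero_iff.2 z.2
    simp [G, smul_smul, hz]
  have hint : Integrable G ((volume : Measure Space).toSphere.prod (.volumeIoiPow 2)) := by
    have h := (hmp.integrable_comp_emb hemb (g := G))
    simp only [finrank_euclideanSpace, Fintype.card_fin] at h
    refine h.1 ?_
    have h2 : G ∘ homeomorphUnitSphereProd Space = F ∘ (↑) := funext hG
    rw [h2, ← integrableOn_iff_comap_subtypeVal (measurableSet_singleton _).compl]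
    exact hF.integrableOn
  calc ∫ z, F z = ∫ z : ({(0)}ᶜ : Set Space), F z ∂(volume.comap Subtype.val) := by
        rw [integral_subtype_comap (measurableSet_singleton _).compl F, restrict_compl_singleton]
    _ = ∫ p, G p ∂(volume : Measure Space).toSphere.prod (.volumeIoiPow 2) := by
        have h := hmp.integral_comp hemb G
        simp only [finrank_euclideanSpace, Fintype.card_fin] at h
        rw [← h]
        exact integral_congr_ae (.of_forall fun z => (hG z).symm)
    _ = ∫ θ : Metric.sphere (0 : Space) 1, ∫ r : Set.Ioi (0 : ℝ), G (θ, r) ∂(.volumeIoiPow 2)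
          ∂(volume : Measure Space).toSphere := integral_prod _ hint
    _ = _ := by
        refine integral_congr_ae (.of_forall fun θ => ?_)
        simp only [Measure.volumeIoiPow, ENNReal.ofReal]
        rw [integral_withDensity_eq_integral_smul (by fun_prop),
          integral_subtype_comap measurableSet_Ioi
            fun r => Real.toNNReal (r ^ 2) • F (r • (θ : Space))]
        refine setIntegral_congr_fun measurableSet_Ioi fun r _ => ?_
        simp [NNReal.smul_def, sq_nonneg]

lemma toSphere_real_univ : (volume : Measure Space).toSphere.real Set.univ = 4 * Real.pi := by
  rw [Measure.toSphere_real_apply_univ, Measure.real, EuclideanSpace.volume_ball_fin_three]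
  rw [ENNReal.toReal_mul]
  simp [ENNReal.toReal_ofReal (by positivity : 0 ≤ Real.pi * 4 / 3)]
  ring

/-- The divergence of the Coulomb field of a test function. -/
theorem sum_integral_coulomb_mul_fderiv (hφ : ContDiff ℝ 1 φ) (hs : HasCompactSupport φ) :
    ∑ j, ∫ z, coulomb j z * fderiv ℝ φ z (basisVec j) = -φ 0 := by
  have hi : ∀ j ∈ Finset.univ,
      Integrable (fun z => coulomb j z * fderiv ℝ φ z (basisVec j)) volume := fun j _ =>
    integrable_coulomb_mul j ((hφ.continuous_fderiv (by norm_num)).clm_apply continuous_const)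
      (hasCompactSupport_fderiv_apply hs _)
  rw [← integral_finsetSum _ hi, integral_eq_integral_sphere (integrable_finsetSum _ hi)]
  have hsum : ∀ z, ∑ j, coulomb j z * fderiv ℝ φ z (basisVec j) =
      fderiv ℝ φ z z / (4 * Real.pi * ‖z‖ ^ 3) := fun z => by
    have hz : z = ∑ j, z j • basisVec j := by
      ext i
      fin_cases i <;> simp [Fin.sum_univ_three, basisVec]
    conv_rhs => rw [show fderiv ℝ φ z z = fderiv ℝ φ z (∑ j, z j • basisVec j) by rw [← hz]]
    rw [map_sum, Finset.sum_div]
    refine Finset.sum_congr rfl fun j _ => ?_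
    rw [map_smul, coulomb, smul_eq_mul]
    ring
  -- The Jacobian `r²` and the factor `r` from the radial derivative cancel `|z|³`. What remains on
  -- each ray is `(4π)⁻¹` times the derivative of `r ↦ φ(rθ)`, whose integral is `-φ 0` by compact
  -- support. Every ray contributes the same, and the sphere has area `4π`.
  have hray : ∀ θ : Metric.sphere (0 : Space) 1,
      ∫ r in Set.Ioi (0 : ℝ), r ^ 2 * ∑ j, coulomb j (r • (θ : Space)) *
        fderiv ℝ φ (r • (θ : Space)) (basisVec j) = (4 * Real.pi)⁻¹ * -φ 0 := fun θ => by
    have hθ : ‖(θ : Space)‖ = 1 := by simp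
    have hc : ContDiff ℝ 1 fun r : ℝ => φ (r • (θ : Space)) :=
      hφ.comp (contDiff_id.smul contDiff_const)
    have hcs : HasCompactSupport fun r : ℝ => φ (r • (θ : Space)) :=
      hs.comp_isClosedEmbedding (isClosedEmbedding_smul_left (norm_ne_zero_iff.1 (by simp)))
    have h := hcs.integral_Ioi_deriv_eq hc 0
    rw [zero_smul] at h
    rw [← h, ← integral_const_mul]
    refine setIntegral_congr_fun measurableSet_Ioi fun r hr => ?_
    have hr' : (0 : ℝ) < r := hr
    have hd : deriv (fun r : ℝ => φ (r • (θ : Space))) r = fderiv ℝ φ (r • (θ : Space)) θ := by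
      have h1 : HasDerivAt (fun r : ℝ => r • (θ : Space)) (θ : Space) r := by
        simpa using (hasDerivAt_id r).smul_const (θ : Space)
      exact ((hφ.differentiable (by norm_num) _).hasFDerivAt.comp_hasDerivAt r h1).deriv
    rw [hsum, hd, map_smul, norm_smul, hθ, smul_eq_mul, Real.norm_of_nonneg hr'.le]
    field_simp
  simp_rw [hray]
  rw [integral_const, toSphere_real_univ, smul_eq_mul]
  field_simp

end Divergence

/-! ### The Coulomb field of a test function: smoothness, curl and divergence. -/

/-- The `j`-th component `y ↦ ∫ (x - y)ⱼ / (4π |x - y|³) ψ(x) dx` of the Coulomb field of a charge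
density `ψ`. -/
noncomputable def coulombField (ψ : Space → ℝ) (j : Fin 3) (y : Space) : ℝ :=
  ∫ x, coulomb j (x - y) * ψ x

section Field

variable {ψ : Space → ℝ}

lemma coulombField_eq_integral_add (ψ : Space → ℝ) (j : Fin 3) (y : Space) :
    coulombField ψ j y = ∫ z, coulomb j z * ψ (y + z) := by
  rw [coulombField, ← integral_sub_right_eq_self (fun z => coulomb j z * ψ (y + z)) y]
  simp

/-- A convolution of a locally integrable kernel with a test function is smooth, and derivatives
fall on the test function. The kernel is reflected because its argument is `x - y`, not `y - x`. -/
lemma coulombField_eq_convolution (ψ : Space → ℝ) (j : Fin 3) :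
    coulombField ψ j = (fun t => coulomb j (-t)) ⋆[ContinuousLinearMap.mul ℝ ℝ, volume] ψ := by
  funext y
  rw [coulombField_eq_integral_add, convolution_def,
    ← integral_neg_eq_self (fun z => coulomb j z * ψ (y + z))]
  simp [sub_eq_add_neg]

lemma coulomb_neg (j : Fin 3) (z : Space) : coulomb j (-z) = -coulomb j z := by
  simp [coulomb, neg_div]

lemma locallyIntegrable_coulomb_neg (j : Fin 3) :
    LocallyIntegrable (fun t => coulomb j (-t)) volume := by
  simp_rw [coulomb_neg]
  exact (locallyIntegrable_coulomb j).neg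

lemma contDiff_coulombField (hψ : ContDiff ℝ ∞ ψ) (hs : HasCompactSupport ψ) (j : Fin 3) :
    ContDiff ℝ ∞ (coulombField ψ j) := by
  rw [coulombField_eq_convolution]
  exact hs.contDiff_convolution_right _ (locallyIntegrable_coulomb_neg j) hψ

lemma fderiv_coulombField_apply (hψ : ContDiff ℝ 1 ψ) (hs : HasCompactSupport ψ) (j : Fin 3)
    (y v : Space) :
    fderiv ℝ (coulombField ψ j) y v = ∫ z, coulomb j z * fderiv ℝ ψ (y + z) v := by
  have h := hs.hasFDerivAt_convolution_right (ContinuousLinearMap.mul ℝ ℝ)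
    (locallyIntegrable_coulomb_neg j) hψ y
  have hi := (hs.fderiv ℝ).convolutionExists_right
    ((ContinuousLinearMap.mul ℝ ℝ).precompR Space) (locallyIntegrable_coulomb_neg j)
    (hψ.continuous_fderiv (by norm_num)) y
  rw [coulombField_eq_convolution, h.fderiv, convolution_def, ContinuousLinearMap.integral_apply hi,
    ← integral_neg_eq_self (fun z => coulomb j z * fderiv ℝ ψ (y + z) v)]
  simp [sub_eq_add_neg, ContinuousLinearMap.precompR_apply]

lemma fderiv_coulombField_comm (hψ : ContDiff ℝ 2 ψ) (hs : HasCompactSupport ψ) (j k : Fin 3)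
    (y : Space) :
    fderiv ℝ (coulombField ψ j) y (basisVec k) = fderiv ℝ (coulombField ψ k) y (basisVec j) := by
  have h := integral_coulomb_mul_fderiv_comm (φ := fun z => ψ (y + z))
    (hψ.comp (contDiff_const.add contDiff_id)) (hs.comp_homeomorph (Homeomorph.addLeft y)) j k
  have h1 : ContDiff ℝ 1 ψ := hψ.of_le (by norm_num)
  rw [fderiv_coulombField_apply h1 hs, fderiv_coulombField_apply h1 hs]
  simpa only [fderiv_comp_add_left] using h

lemma sum_fderiv_coulombField (hψ : ContDiff ℝ 1 ψ) (hs : HasCompactSupport ψ) (y : Space) :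
    ∑ j, fderiv ℝ (coulombField ψ j) y (basisVec j) = -ψ y := by
  have h := sum_integral_coulomb_mul_fderiv (φ := fun z => ψ (y + z))
    (hψ.comp (contDiff_const.add contDiff_id)) (hs.comp_homeomorph (Homeomorph.addLeft y))
  simp_rw [fderiv_coulombField_apply hψ hs]
  simpa only [fderiv_comp_add_left, add_zero] using h

end Field

/-! ### Inverse-square decay of the Coulomb field. -/

section Decay

lemma integrableOn_inv_norm_sub_sq (M : ℝ) (y : Space) :
    IntegrableOn (fun x : Space => (‖x - y‖ ^ 2)⁻¹) (Metric.closedBall 0 M) volume := by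
  have h : IntegrableOn (fun z : Space => (‖z‖ ^ 2)⁻¹) (Metric.closedBall 0 (M + ‖y‖)) volume :=
    locallyIntegrable_inv_norm_sq.integrableOn_isCompact (isCompact_closedBall _ _)
  have h2 := ((integrable_indicator_iff Metric.isClosed_closedBall.measurableSet).2 h).comp_sub_right
    y
  refine (h2.integrableOn (s := Metric.closedBall 0 M)).congr_fun (fun x hx => ?_)
    Metric.isClosed_closedBall.measurableSet
  refine Set.indicator_of_mem ?_ _
  rw [mem_closedBall_zero_iff] at hx ⊢
  exact (norm_sub_le _ _).trans (by linarith)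

/-- For `|y| ≤ 2M` a translation puts the domain inside the ball of radius `3M`, and `1 + |y|²` is
bounded. For `|y| > 2M` one has `|x - y| ≥ |y| / 2` on the whole ball. -/
lemma exists_setIntegral_inv_norm_sub_sq_le (M : ℝ) :
    ∃ C, 0 ≤ C ∧ ∀ y : Space, ∫ x in Metric.closedBall (0 : Space) M, (‖x - y‖ ^ 2)⁻¹ ≤
      C * (1 + ‖y‖ ^ 2)⁻¹ := by
  -- With `M ≥ 1`, the far region has `|y| ≥ 1`, so `1 + |y|² ≤ 2|y|² ≤ 8|x - y|²`; this is the
  -- source of the constant `8`.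
  wlog hM : 1 ≤ M generalizing M
  · obtain ⟨C, hC, h⟩ := this 1 le_rfl
    refine ⟨C, hC, fun y => (setIntegral_mono_set (integrableOn_inv_norm_sub_sq 1 y)
      (.of_forall fun x => by positivity) ?_).trans (h y)⟩
    exact (Metric.closedBall_subset_closedBall (not_le.1 hM).le).eventuallyLE
  set C₁ := ∫ z in Metric.closedBall (0 : Space) (3 * M), (‖z‖ ^ 2)⁻¹ with hC₁
  set V := (volume : Measure Space).real (Metric.closedBall 0 M) with hV
  have hC₁0 : 0 ≤ C₁ := integral_nonneg fun z => by positivity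
  have hV0 : 0 ≤ V := measureReal_nonneg
  refine ⟨C₁ * (1 + 4 * M ^ 2) + 8 * V, by positivity, fun y => ?_⟩
  have hpos : 0 < 1 + ‖y‖ ^ 2 := by positivity
  rcases le_or_gt ‖y‖ (2 * M) with hy | hy
  · have h1 : ∫ x in Metric.closedBall (0 : Space) M, (‖x - y‖ ^ 2)⁻¹ ≤ C₁ := by
      have h : IntegrableOn (fun z : Space => (‖z‖ ^ 2)⁻¹) (Metric.closedBall 0 (3 * M)) volume :=
        locallyIntegrable_inv_norm_sq.integrableOn_isCompact (isCompact_closedBall _ _)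
      have hm : MeasurableSet (Metric.closedBall (0 : Space) (3 * M)) :=
        Metric.isClosed_closedBall.measurableSet
      have hm' : MeasurableSet (Metric.closedBall (0 : Space) M) :=
        Metric.isClosed_closedBall.measurableSet
      rw [hC₁, ← integral_indicator hm, ← integral_indicator hm',
        ← integral_sub_right_eq_self ((Metric.closedBall (0 : Space) (3 * M)).indicator _) y]
      refine integral_mono ((integrable_indicator_iff hm').2 (integrableOn_inv_norm_sub_sq M y))
        (((integrable_indicator_iff hm).2 h).comp_sub_right y) fun x => ?_
      by_cases hx : x ∈ Metric.closedBall (0 : Space) M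
      swap
      · rw [Set.indicator_of_notMem hx]
        exact Set.indicator_nonneg (fun z _ => by positivity) _
      rw [Set.indicator_of_mem hx]
      refine (Set.indicator_of_mem (f := fun z : Space => (‖z‖ ^ 2)⁻¹) ?_).ge
      rw [mem_closedBall_zero_iff] at hx ⊢
      exact (norm_sub_le _ _).trans (by linarith)
    rw [← div_eq_mul_inv, le_div_iff₀ hpos]
    have h2 : 1 + ‖y‖ ^ 2 ≤ 1 + 4 * M ^ 2 := by nlinarith [norm_nonneg y]
    calc _ ≤ C₁ * (1 + 4 * M ^ 2) := by gcongr
      _ ≤ _ := by linarith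
  · have h1 : ∀ x ∈ Metric.closedBall (0 : Space) M, (‖x - y‖ ^ 2)⁻¹ ≤ 8 * (1 + ‖y‖ ^ 2)⁻¹ := by
      intro x hx
      rw [mem_closedBall_zero_iff] at hx
      have h2 : ‖y‖ - ‖x‖ ≤ ‖x - y‖ := by
        rw [norm_sub_rev]
        exact norm_sub_norm_le y x
      have h3 : ‖y‖ / 2 ≤ ‖x - y‖ := by linarith
      have h4 : 0 < ‖y‖ / 2 := by linarith
      rw [← div_eq_mul_inv, inv_eq_one_div, div_le_div_iff₀ (pow_pos (h4.trans_le h3) 2) hpos]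
      nlinarith
    calc ∫ x in Metric.closedBall (0 : Space) M, (‖x - y‖ ^ 2)⁻¹
        ≤ ∫ x in Metric.closedBall (0 : Space) M, 8 * (1 + ‖y‖ ^ 2)⁻¹ :=
          setIntegral_mono_on (integrableOn_inv_norm_sub_sq M y)
            (integrableOn_const (by exact (isCompact_closedBall _ _).measure_lt_top.ne))
            Metric.isClosed_closedBall.measurableSet h1
      _ = 8 * V * (1 + ‖y‖ ^ 2)⁻¹ := by
          rw [setIntegral_const, smul_eq_mul]
          ring
      _ ≤ _ := by
          gcongr
          nlinarith [mul_nonneg hC₁0 (by positivity : 0 ≤ 1 + 4 * M ^ 2)]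

lemma exists_abs_coulombField_le {ψ : Space → ℝ} (hψ : Continuous ψ) (hs : HasCompactSupport ψ) :
    ∃ C, 0 ≤ C ∧ ∀ j y, |coulombField ψ j y| ≤ C * (1 + ‖y‖ ^ 2)⁻¹ := by
  obtain ⟨M, hM⟩ := hs.isCompact.isBounded.subset_closedBall (0 : Space)
  obtain ⟨C, hC, h⟩ := exists_setIntegral_inv_norm_sub_sq_le M
  obtain ⟨B, hB⟩ := hψ.bounded_above_of_compact_support hs
  have hB0 : 0 ≤ B := (norm_nonneg _).trans (hB 0)
  refine ⟨B * C, by positivity, fun j y => ?_⟩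
  have h0 : ∀ x ∉ Metric.closedBall (0 : Space) M, coulomb j (x - y) * ψ x = 0 := fun x hx => by
    rw [image_eq_zero_of_notMem_tsupport (fun h => hx (hM h)), mul_zero]
  rw [coulombField, ← setIntegral_eq_integral_of_forall_compl_eq_zero h0, ← Real.norm_eq_abs]
  calc _ ≤ ∫ x in Metric.closedBall (0 : Space) M, B * (‖x - y‖ ^ 2)⁻¹ := by
        refine norm_integral_le_of_norm_le ((integrableOn_inv_norm_sub_sq M y).const_mul B)
          (.of_forall fun x => ?_)
        rw [norm_mul, mul_comm]
        exact mul_le_mul (hB x) (abs_coulomb_le j _) (norm_nonneg _) hB0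
    _ = B * ∫ x in Metric.closedBall (0 : Space) M, (‖x - y‖ ^ 2)⁻¹ := integral_const_mul _ _
    _ ≤ B * (C * (1 + ‖y‖ ^ 2)⁻¹) := by gcongr; exact h y
    _ = _ := by ring

end Decay

/-! ### Moving the singular integral onto the test function. -/

section Fubini

variable {h : Space → Spinor}

/-- Integrating first in `x` over the ball costs only `C (1 + |y|²)⁻¹`, which is the weight that
makes `h` integrable. -/
lemma integrable_coulomb_smul_prod (hm : AEStronglyMeasurable h volume)
    (hh : Integrable (fun y => (1 + ‖y‖ ^ 2)⁻¹ • h y) volume) (j : Fin 3) (M : ℝ) :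
    Integrable (fun p : Space × Space => coulomb j (p.1 - p.2) • h p.2)
      ((volume.restrict (Metric.closedBall 0 M)).prod volume) := by
  obtain ⟨C, hC, hle⟩ := exists_setIntegral_inv_norm_sub_sq_le M
  have hmeas : AEStronglyMeasurable (fun p : Space × Space => coulomb j (p.1 - p.2) • h p.2)
      ((volume.restrict (Metric.closedBall 0 M)).prod volume) :=
    ((measurable_coulomb j).comp (measurable_fst.sub measurable_snd)).aestronglyMeasurable.smul
      hm.comp_snd
  have hi : ∀ y, IntegrableOn (fun x => coulomb j (x - y)) (Metric.closedBall 0 M) volume :=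
    fun y => (integrableOn_inv_norm_sub_sq M y).mono'
      ((measurable_coulomb j).comp (measurable_id.sub_const y)).aestronglyMeasurable
      (.of_forall fun x => abs_coulomb_le j _)
  rw [integrable_prod_iff' hmeas]
  refine ⟨.of_forall fun y => (hi y).smul_const (h y), ?_⟩
  have hmeas' : AEStronglyMeasurable (fun y => ∫ x in Metric.closedBall (0 : Space) M,
      ‖coulomb j (x - y) • h y‖) volume :=
    (hmeas.norm.prod_swap).integral_prod_right'
      (f := fun p : Space × Space => ‖coulomb j (p.2 - p.1) • h p.1‖)
  refine (hh.norm.const_mul C).mono' hmeas' (.of_forall fun y => ?_)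
  rw [Real.norm_of_nonneg (integral_nonneg fun x => norm_nonneg _)]
  simp_rw [norm_smul]
  rw [integral_mul_const, Real.norm_of_nonneg (by positivity), ← mul_assoc]
  refine mul_le_mul_of_nonneg_right ((integral_mono (hi y).norm (integrableOn_inv_norm_sub_sq M y)
    fun x => abs_coulomb_le j _).trans (hle y)) (norm_nonneg _)

lemma integral_smul_integral_coulomb {ψ : Space → ℝ} (hψ : Continuous ψ)
    (hs : HasCompactSupport ψ) (hm : AEStronglyMeasurable h volume)
    (hh : Integrable (fun y => (1 + ‖y‖ ^ 2)⁻¹ • h y) volume) (j : Fin 3) :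
    ∫ x, ψ x • ∫ y, coulomb j (x - y) • h y = ∫ y, coulombField ψ j y • h y := by
  obtain ⟨M, hM⟩ := hs.isCompact.isBounded.subset_closedBall (0 : Space)
  obtain ⟨B, hB⟩ := hψ.bounded_above_of_compact_support hs
  have h0 : ∀ x ∉ Metric.closedBall (0 : Space) M, ψ x = 0 := fun x hx =>
    image_eq_zero_of_notMem_tsupport (fun h => hx (hM h))
  have hint : Integrable (fun p : Space × Space => ψ p.1 • coulomb j (p.1 - p.2) • h p.2)
      ((volume.restrict (Metric.closedBall 0 M)).prod volume) :=
    (integrable_coulomb_smul_prod hm hh j M).bdd_smul B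
      (hψ.comp continuous_fst).aestronglyMeasurable (.of_forall fun p => hB p.1)
  rw [← setIntegral_eq_integral_of_forall_compl_eq_zero (s := Metric.closedBall (0 : Space) M)
    fun x hx => by rw [h0 x hx, zero_smul]]
  simp_rw [← integral_smul]
  rw [integral_integral_swap hint]
  refine integral_congr_ae (.of_forall fun y => ?_)
  simp_rw [smul_smul]
  rw [integral_smul_const, coulombField,
    setIntegral_eq_integral_of_forall_compl_eq_zero fun x hx => by rw [h0 x hx, zero_mul]]
  simp_rw [mul_comm]

end Fubini

/-! ### Clifford relations of the Dirac matrices. -/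

section Algebra

/-- The Dirac matrix `αⱼ` as an operator on spinors. -/
noncomputable abbrev diracCLM (j : Fin 3) : Spinor →L[ℂ] Spinor :=
  Matrix.toEuclideanCLM (n := Fin 4) (𝕜 := ℂ) (dirac j)

lemma pauli_mul_self (j : Fin 3) : pauli j * pauli j = 1 := by
  fin_cases j <;> ext a b <;> fin_cases a <;> fin_cases b <;> simp [pauli]

lemma pauli_anticomm {j k : Fin 3} (h : j ≠ k) : pauli j * pauli k = -(pauli k * pauli j) := by
  fin_cases j <;> fin_cases k <;> first
    | exact absurd rfl h
    | (ext a b; fin_cases a <;> fin_cases b <;> simp [pauli])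

lemma dirac_mul (j k : Fin 3) : dirac j * dirac k = Matrix.reindex finSumFinEquiv finSumFinEquiv
    (Matrix.fromBlocks (pauli j * pauli k) 0 0 (pauli j * pauli k)) := by
  simp [dirac, Matrix.submatrix_mul_equiv, Matrix.fromBlocks_multiply]

lemma dirac_mul_self (j : Fin 3) : dirac j * dirac j = 1 := by
  rw [dirac_mul, pauli_mul_self, Matrix.fromBlocks_one]
  simp

lemma dirac_anticomm {j k : Fin 3} (h : j ≠ k) : dirac j * dirac k = -(dirac k * dirac j) := by
  rw [dirac_mul, dirac_mul, pauli_anticomm h]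
  ext a b
  simp only [Matrix.reindex_apply, Matrix.submatrix_apply, Matrix.neg_apply]
  cases finSumFinEquiv.symm a <;> cases finSumFinEquiv.symm b <;> simp

lemma diracCLM_diracCLM_self (j : Fin 3) (v : Spinor) : diracCLM j (diracCLM j v) = v := by
  rw [← mul_apply_eq_comp, ← map_mul, dirac_mul_self, map_one]
  rfl

lemma diracCLM_anticomm {j k : Fin 3} (h : j ≠ k) (v : Spinor) :
    diracCLM j (diracCLM k v) = -diracCLM k (diracCLM j v) := by
  rw [← mul_apply_eq_comp, ← map_mul, dirac_anticomm h, map_neg, map_mul]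
  rfl

/-- The anticommutation relations of the Dirac matrices, contracted with a symmetric array. -/
lemma sum_diracCLM_diracCLM {v : Fin 3 → Fin 3 → Spinor} (hv : ∀ j k, v j k = v k j) :
    ∑ j, ∑ k, diracCLM j (diracCLM k (v j k)) = ∑ j, v j j := by
  simp only [Fin.sum_univ_three, diracCLM_diracCLM_self]
  rw [diracCLM_anticomm (j := 1) (k := 0) (by decide), diracCLM_anticomm (j := 2) (k := 0)
    (by decide), diracCLM_anticomm (j := 2) (k := 1) (by decide), hv 1 0, hv 2 0, hv 2 1]
  abel

lemma kernelApply_eq_sum (g : Space → Spinor) (x y : Space) :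
    kernelApply g x y = ∑ j, coulomb j (x - y) • Complex.I • diracCLM j (g y) := by
  rw [kernelApply, diracDot, map_sum, sum_apply, Finset.smul_sum]
  refine Finset.sum_congr rfl fun j _ => ?_
  rw [map_smul, smul_apply, smul_smul, ← Complex.coe_smul, smul_smul, coulomb]
  congr 1
  push_cast
  ring

end Algebra

/-! ### Weighted spaces. -/

section Weights

lemma weight_pos (s : ℝ) (x : Space) : 0 < weight s x :=
  Real.rpow_pos_of_pos (Real.sqrt_pos.2 (by positivity)) s

lemma weight_eq_rpow (s : ℝ) (x : Space) : weight s x = (1 + ‖x‖ ^ 2) ^ (s / 2) := by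
  rw [weight, Real.sqrt_eq_rpow, ← Real.rpow_mul (by positivity)]
  congr 1
  ring

lemma weight_add (s t : ℝ) (x : Space) : weight (s + t) x = weight s x * weight t x :=
  Real.rpow_add (Real.sqrt_pos.2 (by positivity)) s t

lemma continuous_weight (s : ℝ) : Continuous (weight s) := by
  rw [show weight s = _ from funext (weight_eq_rpow s)]
  exact Continuous.rpow_const (by fun_prop) fun x => Or.inl (by positivity)

lemma weight_neg_smul_weight_smul (s : ℝ) (x : Space) (v : Spinor) :
    weight (-s) x • (weight s x : ℂ) • v = v := by
  rw [← Complex.coe_smul, smul_smul, weight_neg_mul_weight, one_smul]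

lemma MemWeightedL2.locallyIntegrable {s : ℝ} {f : Space → Spinor} (hf : MemWeightedL2 s f) :
    LocallyIntegrable f volume := by
  have h := (MemLp.locallyIntegrable hf (by norm_num)).continuous_smul (continuous_weight (-s))
  simpa only [weight_neg_smul_weight_smul] using h

/-- By Cauchy–Schwarz it suffices that `⟨y⟩^(-2-s)` is in `L²(ℝ³)`, that is `4 + 2s > 3`; this fixes
the threshold `-1/2`. -/
lemma MemWeightedL2.integrable_inv_smul {s : ℝ} (hs : -1 / 2 < s) {g : Space → Spinor}
    (hg : MemWeightedL2 s g) : Integrable (fun y => (1 + ‖y‖ ^ 2)⁻¹ • g y) volume := by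
  have hw : MemLp (weight (-2 - s)) 2 volume := by
    rw [memLp_two_iff_integrable_sq (continuous_weight _).aestronglyMeasurable]
    have h := integrable_rpow_neg_one_add_norm_sq (E := Space) (μ := volume) (r := 4 + 2 * s)
      (by simp; linarith)
    refine h.congr (.of_forall fun x => ?_)
    simp only
    rw [sq (weight _ _), ← weight_add, weight_eq_rpow]
    congr 1
    ring
  have h : MemLp (weight (-2 - s) • fun x => (weight s x : ℂ) • g x) 1 volume := hg.smul hw
  refine (memLp_one_iff_integrable.1 h).congr (.of_forall fun x => ?_)
  simp only [Pi.smul_apply']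
  rw [show -2 - s = -2 + -s by ring, weight_add, mul_smul, weight_neg_smul_weight_smul,
    weight_eq_rpow]
  norm_num [Real.rpow_neg_one]

end Weights

/-! ### Cutoff functions. -/

section Cutoff

/-- The spherical shell `r ≤ |x| ≤ 2r`. -/
def shell (r : ℝ) : Set Space := {x | r ≤ ‖x‖ ∧ ‖x‖ ≤ 2 * r}

lemma measurableSet_shell (r : ℝ) : MeasurableSet (shell r) :=
  (measurableSet_le measurable_const measurable_norm).inter
    (measurableSet_le measurable_norm measurable_const)

/-- Smooth cutoffs at scale `r` with derivatives of size `1 / r`, supported in a shell. -/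
lemma exists_cutoff : ∃ (χ : ℝ → Space → ℝ) (C : ℝ), 0 ≤ C ∧ ∀ r, 0 < r →
    ContDiff ℝ ∞ (χ r) ∧ HasCompactSupport (χ r) ∧ (∀ x, |χ r x| ≤ 1) ∧
    (∀ x, ‖x‖ ≤ r → χ r x = 1) ∧ (∀ x, ‖fderiv ℝ (χ r) x‖ ≤ C * r⁻¹) ∧
    (∀ x ∉ shell r, fderiv ℝ (χ r) x = 0) := by
  let b : ContDiffBump (0 : Space) := ⟨1, 2, one_pos, one_lt_two⟩
  obtain ⟨C, hC⟩ := (b.hasCompactSupport.fderiv ℝ).exists_bound_of_continuous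
    (b.contDiff.continuous_fderiv (n := 1) (by norm_num))
  refine ⟨fun r x => b (r⁻¹ • x), C, (norm_nonneg _).trans (hC 0),
    fun r hr => ⟨?_, ?_, ?_, ?_, ?_, ?_⟩⟩
  · exact b.contDiff.comp (contDiff_const_smul r⁻¹)
  · exact b.hasCompactSupport.comp_homeomorph (Homeomorph.smulOfNeZero r⁻¹ (inv_ne_zero hr.ne'))
  · intro x
    rw [abs_of_nonneg b.nonneg]
    exact b.le_one
  · intro x hx
    refine b.one_of_mem_closedBall ?_
    rw [mem_closedBall_zero_iff, norm_smul, norm_inv, Real.norm_of_nonneg hr.le]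
    exact (inv_mul_le_one₀ hr).2 hx
  · intro x
    rw [fderiv_comp_smul, norm_smul, norm_inv, Real.norm_of_nonneg hr.le, mul_comm]
    gcongr
    exact hC _
  · intro x hx
    have hn : ‖r⁻¹ • x‖ = r⁻¹ * ‖x‖ := by
      rw [norm_smul, norm_inv, Real.norm_of_nonneg hr.le]
    rw [fderiv_comp_smul]
    -- Off the shell, `x` lies either in the open ball where the cutoff is constantly `1`, or
    -- strictly outside its support.
    rcases lt_or_ge ‖x‖ r with h | h
    · have h1 : (b : Space → ℝ) =ᶠ[𝓝 (r⁻¹ • x)] 1 := b.eventuallyEq_one_of_mem_ball (by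
        rw [mem_ball_zero_iff, hn]
        exact (inv_mul_lt_one₀ hr).2 h)
      rw [h1.fderiv_eq]
      simp
    · have h2 : 2 * r < ‖x‖ := not_le.1 fun h' => hx ⟨h, h'⟩
      rw [image_eq_zero_of_notMem_tsupport (f := fderiv ℝ b), smul_zero]
      refine fun h3 => ?_
      have h4 := tsupport_fderiv_subset ℝ h3
      rw [b.tsupport_eq, mem_closedBall_zero_iff, hn, inv_mul_le_iff₀ hr] at h4
      change ‖x‖ ≤ r * 2 at h4
      linarith

end Cutoff

/-! ### Boundary terms on expanding shells. -/

section Shell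

variable {F : Space → Spinor}

/-- Cauchy–Schwarz against the constant `1`; the shell lies in the ball of radius `2r`, whence the
factor `8 r³`. -/
lemma setIntegral_shell_norm_le (hF : MemLp F 2 volume) {r : ℝ} (hr : 0 ≤ r) :
    ∫ x in shell r, ‖F x‖ ≤ Real.sqrt (8 * r ^ 3 * (volume : Measure Space).real (Metric.ball 0 1)) *
      Real.sqrt (∫ x in shell r, ‖F x‖ ^ 2) := by
  have hsub : shell r ⊆ Metric.closedBall 0 (2 * r) := fun x hx =>
    mem_closedBall_zero_iff.2 hx.2
  have hfin : (volume : Measure Space) (Metric.closedBall 0 (2 * r)) ≠ ⊤ :=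
    (isCompact_closedBall _ _).measure_lt_top.ne
  have hvol : (volume : Measure Space).real (shell r) ≤
      8 * r ^ 3 * (volume : Measure Space).real (Metric.ball 0 1) := by
    refine (measureReal_mono hsub hfin).trans ?_
    rw [Measure.addHaar_real_closedBall _ _ (by positivity)]
    simp only [finrank_euclideanSpace, Fintype.card_fin]
    exact le_of_eq (by ring)
  have : IsFiniteMeasure ((volume : Measure Space).restrict (shell r)) :=
    ⟨by simpa using (measure_mono hsub).trans_lt hfin.lt_top⟩
  have h := integral_mul_le_Lp_mul_Lq_of_nonneg (μ := volume.restrict (shell r))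
    Real.HolderConjugate.two_two (f := fun _ => (1 : ℝ)) (g := fun x => ‖F x‖)
    (.of_forall fun _ => zero_le_one) (.of_forall fun x => norm_nonneg _) (memLp_const _)
    (by simpa using hF.norm.restrict (shell r))
  simp only [one_mul, integral_const, smul_eq_mul, Real.rpow_ofNat, one_pow, mul_one,
    measureReal_restrict_apply_univ, ← Real.sqrt_eq_rpow] at h
  refine h.trans ?_
  gcongr

/-- Each point leaves the shells eventually, so dominated convergence applies. -/
lemma tendsto_setIntegral_shell (hF : MemLp F 2 volume) :
    Tendsto (fun n : ℕ => ∫ x in shell ((n : ℝ) + 1), ‖F x‖ ^ 2) atTop (𝓝 0) := by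
  have hi : Integrable (fun x => ‖F x‖ ^ 2) volume := hF.integrable_norm_pow two_ne_zero
  have h := tendsto_integral_of_dominated_convergence
    (F := fun (n : ℕ) x => (shell ((n : ℝ) + 1)).indicator (fun x => ‖F x‖ ^ 2) x)
    (f := fun _ => (0 : ℝ)) (fun x => ‖F x‖ ^ 2)
    (fun n => (hi.indicator (measurableSet_shell _)).aestronglyMeasurable) hi
    (fun n => .of_forall fun x => ?_) (.of_forall fun x => ?_)
  · simpa only [integral_indicator (measurableSet_shell _), integral_zero] using h
  · exact (norm_indicator_le_norm_self _ _).trans (by simp)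
  · refine tendsto_const_nhds.congr' ?_
    filter_upwards [eventually_ge_atTop ⌈‖x‖⌉₊] with n hn
    refine (Set.indicator_of_notMem (fun hx => ?_) _).symm
    have := hx.1
    have := Nat.ceil_le.1 hn
    linarith

/-- Boundary terms on the shells `n + 1 ≤ |x| ≤ 2 (n + 1)` vanish in the limit. -/
lemma tendsto_integral_smul_of_shell {f : Space → Spinor} (hf : MemWeightedL2 (-3 / 2) f)
    {w : ℕ → Space → ℝ} {C : ℝ} (hC : 0 ≤ C)
    (hw : ∀ (n : ℕ) x, |w n x| ≤ C * (1 + ‖x‖ ^ 2)⁻¹ * ((n : ℝ) + 1)⁻¹)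
    (hw0 : ∀ n : ℕ, ∀ x ∉ shell ((n : ℝ) + 1), w n x = 0) :
    Tendsto (fun n : ℕ => ∫ x, w n x • f x) atTop (𝓝 0) := by
  set F : Space → Spinor := fun x => (weight (-3 / 2) x : ℂ) • f x with hFdef
  have hF : MemLp F 2 volume := hf
  set V := (volume : Measure Space).real (Metric.ball 0 1) with hV
  -- The decay `⟨x⟩⁻²` against the growth `⟨x⟩^(3/2)` of `f` relative to `F` leaves `r^(-1/2)` on
  -- the shell; the cutoff gradient adds `r⁻¹`.
  have hpt : ∀ (n : ℕ), ∀ x ∈ shell ((n : ℝ) + 1),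
      ‖w n x • f x‖ ≤ C * (Real.sqrt (((n : ℝ) + 1) ^ 3))⁻¹ * ‖F x‖ := by
    intro n x hx
    set r : ℝ := (n : ℝ) + 1
    have hr : 0 < r := by positivity
    have hfx : ‖f x‖ = weight (3 / 2) x * ‖F x‖ := by
      conv_lhs => rw [← weight_neg_smul_weight_smul (-3 / 2) x (f x)]
      rw [norm_smul, Real.norm_of_nonneg (weight_pos _ _).le,
        show -(-3 / 2 : ℝ) = 3 / 2 by norm_num]
    have hinv : (1 + ‖x‖ ^ 2)⁻¹ = weight (-2) x := by
      rw [weight_eq_rpow]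
      norm_num [Real.rpow_neg_one]
    have hdecay : weight (-2) x * weight (3 / 2) x ≤ (Real.sqrt r)⁻¹ := by
      rw [← weight_add, weight, show (-2 + 3 / 2 : ℝ) = -(1 / 2) by norm_num,
        Real.rpow_neg (Real.sqrt_nonneg _), ← Real.sqrt_eq_rpow]
      gcongr
      exact hx.1.trans (Real.le_sqrt_of_sq_le (by linarith))
    have hsq : (Real.sqrt (r ^ 3))⁻¹ = (Real.sqrt r)⁻¹ * r⁻¹ := by
      rw [pow_succ, Real.sqrt_mul (by positivity), Real.sqrt_sq hr.le, mul_inv, mul_comm]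
    rw [norm_smul, hfx, hsq]
    calc ‖w n x‖ * (weight (3 / 2) x * ‖F x‖)
        ≤ (C * weight (-2) x * r⁻¹) * (weight (3 / 2) x * ‖F x‖) := by
          have := (weight_pos (3 / 2) x).le
          gcongr
          rw [← hinv]
          exact hw n x
      _ = C * ((weight (-2) x * weight (3 / 2) x) * r⁻¹) * ‖F x‖ := by ring
      _ ≤ _ := by gcongr
  have hbound : ∀ n : ℕ, ‖∫ x, w n x • f x‖ ≤
      C * Real.sqrt (8 * V) * Real.sqrt (∫ x in shell ((n : ℝ) + 1), ‖F x‖ ^ 2) := by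
    intro n
    have hr : (0 : ℝ) < (n : ℝ) + 1 := by positivity
    have hFi : IntegrableOn F (shell ((n : ℝ) + 1)) volume :=
      ((hF.locallyIntegrable (by norm_num)).integrableOn_isCompact
        (isCompact_closedBall (0 : Space) (2 * ((n : ℝ) + 1)))).mono_set
        fun x hx => mem_closedBall_zero_iff.2 hx.2
    rw [← setIntegral_eq_integral_of_forall_compl_eq_zero (s := shell ((n : ℝ) + 1))
      fun x hx => by rw [hw0 n x hx, zero_smul]]
    calc _ ≤ ∫ x in shell ((n : ℝ) + 1), C * (Real.sqrt (((n : ℝ) + 1) ^ 3))⁻¹ * ‖F x‖ :=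
          norm_integral_le_of_norm_le (hFi.norm.const_mul _)
            ((ae_restrict_iff' (measurableSet_shell _)).2 (.of_forall (hpt n)))
      _ = C * (Real.sqrt (((n : ℝ) + 1) ^ 3))⁻¹ * ∫ x in shell ((n : ℝ) + 1), ‖F x‖ :=
          integral_const_mul _ _
      _ ≤ C * (Real.sqrt (((n : ℝ) + 1) ^ 3))⁻¹ * (Real.sqrt (8 * ((n : ℝ) + 1) ^ 3 * V) *
            Real.sqrt (∫ x in shell ((n : ℝ) + 1), ‖F x‖ ^ 2)) := by
          gcongr
          exact setIntegral_shell_norm_le hF hr.le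
      -- The factor `r^(3/2)` from the volume cancels `r^(-3/2)` exactly, so the decay comes only
      -- from the `L²` tail of `F`.
      _ = _ := by
          rw [show 8 * ((n : ℝ) + 1) ^ 3 * V = ((n : ℝ) + 1) ^ 3 * (8 * V) by ring,
            Real.sqrt_mul (by positivity)]
          have : Real.sqrt (((n : ℝ) + 1) ^ 3) ≠ 0 := (Real.sqrt_pos.2 (by positivity)).ne'
          field_simp
  refine squeeze_zero_norm hbound ?_
  have h := ((tendsto_setIntegral_shell hF).sqrt).const_mul (C * Real.sqrt (8 * V))
  simpa using h

end Shell

/-! ### The equation against test functions. -/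

section Equation

variable {f g : Space → Spinor} {s : ℝ}

/-- The distributional equation `H₀ f = g` tested against a real test function. -/
lemma integral_smul_of_freeDirac_eq (hf : MemWeightedL2 (-3 / 2) f) (hg : MemWeightedL2 s g)
    (hfg : freeDirac (toDistribution hf) = toDistribution hg) {φ : Space → ℝ}
    (hφ : ContDiff ℝ ∞ φ) (hs : HasCompactSupport φ) :
    Complex.I • ∫ x, φ x • g x =
      -∑ k, diracCLM k (∫ x, fderiv ℝ φ x (basisVec k) • f x) := by
  have hφ' : ContDiff ℝ ∞ fun x => (φ x : ℂ) := Complex.ofRealCLM.contDiff.comp hφ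
  have hs' : HasCompactSupport fun x => (φ x : ℂ) := hs.comp_left (g := Complex.ofReal) (by simp)
  let Φ : 𝓢(Space, ℂ) := hs'.toSchwartzMap hφ'
  have h := congrArg (fun u => u Φ) hfg
  simp only [freeDirac_apply, toDistribution_apply] at h
  have h1 : ∫ x, Φ x • g x = ∫ x, φ x • g x := rfl
  have h2 : ∀ k, ∫ x, (-∂_{basisVec k} Φ) x • f x =
      -∫ x, fderiv ℝ φ x (basisVec k) • f x := fun k => by
    rw [← integral_neg]
    refine integral_congr_ae (.of_forall fun x => ?_)
    have h3 : fderiv ℝ (Φ : Space → ℂ) x (basisVec k) = (fderiv ℝ φ x (basisVec k) : ℂ) := by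
      have h4 : HasFDerivAt (fun x => (φ x : ℂ)) (Complex.ofRealCLM ∘L fderiv ℝ φ x) x :=
        Complex.ofRealCLM.hasFDerivAt.comp x
          (hφ.differentiable (by norm_num) x).hasFDerivAt
      exact congrArg (fun L => L (basisVec k)) h4.fderiv
    simp only
    rw [neg_apply, SchwartzMap.lineDerivOp_apply_eq_fderiv, h3, neg_smul,
      Complex.coe_smul]
  simp only [h1, h2] at h
  rw [← h, Finset.smul_sum, ← Finset.sum_neg_distrib]
  refine Finset.sum_congr rfl fun k _ => ?_
  rw [map_smul, map_neg, smul_smul]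
  simp

end Equation

/-! ### The cut-off identity and its limit. -/

section Limit

variable {f g : Space → Spinor} {s : ℝ} {ψ : Space → ℝ}

lemma integrable_coulombField_smul (hψ : ContDiff ℝ ∞ ψ) (hs : HasCompactSupport ψ)
    {h : Space → Spinor} (hm : AEStronglyMeasurable h volume)
    (hh : Integrable (fun y => (1 + ‖y‖ ^ 2)⁻¹ • h y) volume) (j : Fin 3) :
    Integrable (fun y => coulombField ψ j y • h y) volume := by
  obtain ⟨C, hC, hle⟩ := exists_abs_coulombField_le hψ.continuous hs
  refine (hh.norm.const_mul C).mono'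
    ((contDiff_coulombField hψ hs j).continuous.aestronglyMeasurable.smul hm)
    (.of_forall fun y => ?_)
  rw [norm_smul, norm_smul, ← mul_assoc, Real.norm_of_nonneg (by positivity : 0 ≤ (1 + ‖y‖ ^ 2)⁻¹)]
  gcongr
  exact hle j y

/-- The equation is tested against `χ uⱼ`, with `u` the Coulomb field of `ψ`, and expanded by
Leibniz. Where the derivative falls on `u`, symmetry of `∂ₖ uⱼ` and the Clifford relations leave
only the divergence `-ψ`. -/
lemma sum_integral_cutoff_smul (hf : MemWeightedL2 (-3 / 2) f) (hg : MemWeightedL2 s g)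
    (hfg : freeDirac (toDistribution hf) = toDistribution hg) (hψ : ContDiff ℝ ∞ ψ)
    (hs : HasCompactSupport ψ) {χ : Space → ℝ} (hχ : ContDiff ℝ ∞ χ) (hχs : HasCompactSupport χ) :
    ∑ j, ∫ y, (χ y * coulombField ψ j y) • Complex.I • diracCLM j (g y) =
      (∫ y, (χ y * ψ y) • f y) - ∑ j, ∑ k, diracCLM j (diracCLM k
        (∫ y, (coulombField ψ j y * fderiv ℝ χ y (basisVec k)) • f y)) := by
  have hu := contDiff_coulombField hψ hs
  have hψ2 : ContDiff ℝ 2 ψ := by exact_mod_cast contDiff_infty.1 hψ 2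
  have hfl := hf.locallyIntegrable
  have hgl := hg.locallyIntegrable
  have hdχ : ∀ k, Continuous fun y => fderiv ℝ χ y (basisVec k) := fun k =>
    (hχ.continuous_fderiv (by simp)).clm_apply continuous_const
  have hdu : ∀ j k, Continuous fun y => fderiv ℝ (coulombField ψ j) y (basisVec k) := fun j k =>
    ((hu j).continuous_fderiv (by simp)).clm_apply continuous_const
  have hi1 : ∀ j k, Integrable
      (fun y => (χ y * fderiv ℝ (coulombField ψ j) y (basisVec k)) • f y) volume := fun j k =>
    hfl.integrable_smul_left_of_hasCompactSupport (hχ.continuous.mul (hdu j k)) hχs.mul_right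
  have hi2 : ∀ j k, Integrable
      (fun y => (coulombField ψ j y * fderiv ℝ χ y (basisVec k)) • f y) volume := fun j k =>
    hfl.integrable_smul_left_of_hasCompactSupport ((hu j).continuous.mul (hdχ k))
      (hasCompactSupport_fderiv_apply hχs _).mul_left
  have hterm : ∀ j, ∫ y, (χ y * coulombField ψ j y) • Complex.I • diracCLM j (g y) =
      -∑ k, diracCLM j (diracCLM k
        (∫ y, (χ y * fderiv ℝ (coulombField ψ j) y (basisVec k)) • f y)) -
      ∑ k, diracCLM j (diracCLM k
        (∫ y, (coulombField ψ j y * fderiv ℝ χ y (basisVec k)) • f y)) := fun j => by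
    have hgi : Integrable (fun y => (χ y * coulombField ψ j y) • g y) volume :=
      hgl.integrable_smul_left_of_hasCompactSupport (hχ.continuous.mul (hu j).continuous)
        hχs.mul_right
    have h1 : ∫ y, (χ y * coulombField ψ j y) • Complex.I • diracCLM j (g y) =
        diracCLM j (Complex.I • ∫ y, (χ y * coulombField ψ j y) • g y) := by
      rw [map_smul, ← ContinuousLinearMap.integral_comp_comm _ hgi, ← integral_smul]
      refine integral_congr_ae (.of_forall fun y => ?_)
      simp only
      rw [smul_comm, ← Complex.coe_smul, ← Complex.coe_smul, map_smul]
    rw [h1, integral_smul_of_freeDirac_eq hf hg hfg (hχ.mul (hu j)) hχs.mul_right, map_neg,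
      map_sum, ← neg_add', ← Finset.sum_add_distrib]
    congr 1
    refine Finset.sum_congr rfl fun k _ => ?_
    rw [← map_add, ← map_add, ← integral_add (hi1 j k) (hi2 j k)]
    congr 2
    refine integral_congr_ae (.of_forall fun y => ?_)
    simp only
    rw [fderiv_fun_mul (hχ.differentiable (by simp) y) ((hu j).differentiable (by simp) y),
      ← add_smul]
    simp
  simp_rw [hterm]
  rw [Finset.sum_sub_distrib, Finset.sum_neg_distrib, sum_diracCLM_diracCLM fun j k => by
    simp_rw [fderiv_coulombField_comm hψ2 hs j k], ← integral_finsetSum _ fun j _ => hi1 j j,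
    ← integral_neg]
  congr 1
  refine integral_congr_ae (.of_forall fun y => ?_)
  simp only
  rw [← Finset.sum_smul, ← Finset.mul_sum, sum_fderiv_coulombField (hψ2.of_le (by norm_num)) hs]
  simp

/-- The cutoff is removed by letting its scale tend to infinity. The terms carrying `χ` itself
converge by dominated convergence, and those carrying its gradient are boundary terms on shells. -/
theorem sum_integral_coulombField_smul (hf : MemWeightedL2 (-3 / 2) f)
    (hg : MemWeightedL2 s g)
    (hfg : freeDirac (toDistribution hf) = toDistribution hg) (hψ : ContDiff ℝ ∞ ψ)
    (hs : HasCompactSupport ψ)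
    (hh : ∀ j, Integrable (fun y => coulombField ψ j y • Complex.I • diracCLM j (g y)) volume) :
    ∑ j, ∫ y, coulombField ψ j y • Complex.I • diracCLM j (g y) = ∫ y, ψ y • f y := by
  obtain ⟨χ, C, hC, hχ⟩ := exists_cutoff
  obtain ⟨B, hB, hle⟩ := exists_abs_coulombField_le hψ.continuous hs
  have hpos : ∀ n : ℕ, (0 : ℝ) < (n : ℝ) + 1 := fun n => by positivity
  have hlim : ∀ (k : Space → Spinor), Integrable k volume →
      Tendsto (fun n : ℕ => ∫ y, χ ((n : ℝ) + 1) y • k y) atTop (𝓝 (∫ y, k y)) := by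
    intro k hk
    refine tendsto_integral_of_dominated_convergence (fun y => ‖k y‖)
      (fun n => (hχ _ (hpos n)).1.continuous.aestronglyMeasurable.smul hk.aestronglyMeasurable)
      hk.norm (fun n => .of_forall fun y => ?_) (.of_forall fun y => ?_)
    · rw [norm_smul]
      exact mul_le_of_le_one_left (norm_nonneg _) ((hχ _ (hpos n)).2.2.1 y)
    · refine tendsto_const_nhds.congr' ?_
      filter_upwards [eventually_ge_atTop ⌈‖y‖⌉₊] with n hn
      rw [(hχ _ (hpos n)).2.2.2.1 y (by linarith [Nat.ceil_le.1 hn]), one_smul]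
  have h1 : Tendsto (fun n : ℕ => ∑ j, ∫ y, (χ ((n : ℝ) + 1) y * coulombField ψ j y) •
      Complex.I • diracCLM j (g y)) atTop
      (𝓝 (∑ j, ∫ y, coulombField ψ j y • Complex.I • diracCLM j (g y))) := by
    simp_rw [mul_smul]
    exact tendsto_finsetSum _ fun j _ => hlim _ (hh j)
  have h2 : Tendsto (fun n : ℕ => ∫ y, (χ ((n : ℝ) + 1) y * ψ y) • f y) atTop
      (𝓝 (∫ y, ψ y • f y)) := by
    simp_rw [mul_smul]
    exact hlim _ (hf.locallyIntegrable.integrable_smul_left_of_hasCompactSupport hψ.continuous hs)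
  have h3 : ∀ j k, Tendsto (fun n : ℕ => ∫ y, (coulombField ψ j y *
      fderiv ℝ (χ ((n : ℝ) + 1)) y (basisVec k)) • f y) atTop (𝓝 0) := fun j k => by
    refine tendsto_integral_smul_of_shell hf (mul_nonneg hB hC) (fun n y => ?_) fun n y hy => ?_
    · have hd : |fderiv ℝ (χ ((n : ℝ) + 1)) y (basisVec k)| ≤ C * ((n : ℝ) + 1)⁻¹ :=
        ((fderiv ℝ (χ ((n : ℝ) + 1)) y).le_of_opNorm_le ((hχ _ (hpos n)).2.2.2.2.1 y) _).trans
          (by simp [basisVec])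
      rw [abs_mul]
      calc _ ≤ (B * (1 + ‖y‖ ^ 2)⁻¹) * (C * ((n : ℝ) + 1)⁻¹) := by
            gcongr
            exact hle j y
        _ = _ := by ring
    · rw [(hχ _ (hpos n)).2.2.2.2.2 y hy]
      simp
  have h4 : Tendsto (fun n : ℕ => ∑ j, ∑ k, diracCLM j (diracCLM k (∫ y, (coulombField ψ j y *
      fderiv ℝ (χ ((n : ℝ) + 1)) y (basisVec k)) • f y))) atTop (𝓝 0) := by
    have h := tendsto_finsetSum Finset.univ fun j _ => tendsto_finsetSum Finset.univ fun k _ =>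
      (((diracCLM j).continuous.comp (diracCLM k).continuous).tendsto 0).comp (h3 j k)
    simpa [Function.comp_def] using h
  refine tendsto_nhds_unique h1 ?_
  have h5 := h2.sub h4
  rw [sub_zero] at h5
  exact h5.congr fun n => (sum_integral_cutoff_smul hf hg hfg hψ hs (hχ _ (hpos n)).1
    (hχ _ (hpos n)).2.1).symm

end Limit

/-! ### Almost everywhere convergence and conclusion. -/

section Main

variable {h : Space → Spinor}

/-- Fubini gives the claim almost everywhere on each ball, and countably many balls cover the space.
-/
lemma ae_integrable_coulomb_smul (hm : AEStronglyMeasurable h volume)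
    (hh : Integrable (fun y => (1 + ‖y‖ ^ 2)⁻¹ • h y) volume) (j : Fin 3) :
    ∀ᵐ x, Integrable (fun y => coulomb j (x - y) • h y) volume := by
  have H : ∀ n : ℕ, ∀ᵐ x, x ∈ Metric.closedBall (0 : Space) n →
      Integrable (fun y => coulomb j (x - y) • h y) volume := fun n =>
    (ae_restrict_iff' Metric.isClosed_closedBall.measurableSet).1
      (integrable_coulomb_smul_prod hm hh j n).prod_right_ae
  filter_upwards [ae_all_iff.2 H] with x hx
  obtain ⟨n, hn⟩ := exists_nat_ge ‖x‖
  exact hx n (mem_closedBall_zero_iff.2 hn)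

lemma locallyIntegrable_integral_coulomb_smul (hm : AEStronglyMeasurable h volume)
    (hh : Integrable (fun y => (1 + ‖y‖ ^ 2)⁻¹ • h y) volume) (j : Fin 3) :
    LocallyIntegrable (fun x => ∫ y, coulomb j (x - y) • h y) volume := by
  rw [locallyIntegrable_iff]
  intro K hK
  obtain ⟨M, hM⟩ := hK.isBounded.subset_closedBall (0 : Space)
  have hi : IntegrableOn (fun x => ∫ y, coulomb j (x - y) • h y)
      (Metric.closedBall 0 M) volume := (integrable_coulomb_smul_prod hm hh j M).integral_prod_left
  exact hi.mono_set hM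

/-- `A H₀ f = f` for `f ∈ 𝓛^{2,-3/2}` with `H₀ f ∈ 𝓛^{2,s}`; here `s > -1/2` is enough. -/
theorem ae_integrable_kernelApply_and_opA_eq {f g : Space → Spinor} {s : ℝ} (hs : -1 / 2 < s)
    (hf : MemWeightedL2 (-3 / 2) f) (hg : MemWeightedL2 s g)
    (hfg : freeDirac (toDistribution hf) = toDistribution hg) :
    ∀ᵐ x : Space ∂volume, Integrable (kernelApply g x) volume ∧ opA g x = f x := by
  have hgm : AEStronglyMeasurable g volume := hg.locallyIntegrable.aestronglyMeasurable
  have hgw := hg.integrable_inv_smul hs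
  have hm : ∀ j, AEStronglyMeasurable (fun y => Complex.I • diracCLM j (g y)) volume := fun j =>
    ((diracCLM j).continuous.comp_aestronglyMeasurable hgm).const_smul Complex.I
  have hw : ∀ j, Integrable (fun y => (1 + ‖y‖ ^ 2)⁻¹ • Complex.I • diracCLM j (g y)) volume :=
    fun j => by
      refine (((diracCLM j).integrable_comp hgw).smul Complex.I).congr (.of_forall fun y => ?_)
      simp only [Pi.smul_apply]
      rw [smul_comm _ Complex.I, ← Complex.coe_smul, ← Complex.coe_smul, map_smul]
  have hA : ∀ᵐ x, ∑ j, ∫ y, coulomb j (x - y) • Complex.I • diracCLM j (g y) = f x := by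
    have hloc := fun j => locallyIntegrable_integral_coulomb_smul (hm j) (hw j) j
    -- Both sides are locally integrable, so almost everywhere equality follows from equality
    -- against all real test functions.
    refine ae_eq_of_integral_contDiff_smul_eq ?_ hf.locallyIntegrable fun ψ hψ hψs => ?_
    · exact locallyIntegrable_finsetSum _ fun j _ => hloc j
    · simp_rw [Finset.smul_sum]
      rw [integral_finsetSum _ fun j _ =>
        (hloc j).integrable_smul_left_of_hasCompactSupport hψ.continuous hψs,
        ← sum_integral_coulombField_smul hf hg hfg hψ hψs fun j =>
          integrable_coulombField_smul hψ hψs (hm j) (hw j) j]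
      exact Finset.sum_congr rfl fun j _ =>
        integral_smul_integral_coulomb hψ.continuous hψs (hm j) (hw j) j
  filter_upwards [hA, ae_all_iff.2 fun j => ae_integrable_coulomb_smul (hm j) (hw j) j] with x hx hi
  have hk : kernelApply g x = fun y => ∑ j, coulomb j (x - y) • Complex.I • diracCLM j (g y) :=
    funext (kernelApply_eq_sum g x)
  rw [opA, hk, integral_finsetSum _ fun j _ => hi j]
  exact ⟨integrable_finsetSum _ fun j _ => hi j, hx⟩

end Main

end MasslessDirac

theorem mainTheorem3 (f g : MasslessDirac.Space → MasslessDirac.Spinor)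
    (hf : MasslessDirac.MemWeightedL2 (-3 / 2) f)
    (s : ℝ) (hs : 1 / 2 < s) (hg : MasslessDirac.MemWeightedL2 s g)
    (hfg : MasslessDirac.freeDirac (MasslessDirac.toDistribution hf) =
      MasslessDirac.toDistribution hg) :
    ∀ᵐ x : MasslessDirac.Space ∂volume,
      Integrable (MasslessDirac.kernelApply g x) volume ∧ MasslessDirac.opA g x = f x :=
  MasslessDirac.ae_integrable_kernelApply_and_opA_eq (by linarith) hf hg hfg
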